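/- Let $p\in(2^{-1/4},1)$ and $u>0$. Let $\mathbb{Q}$ be the geometric distribution on $\mathbb{N}=\{1,2,\dots\}$ with $\mathbb{Q}(\{k\})=(1-p)p^{k-1}$, and let $\eta$ be a marked Poisson process on $\mathbb{R}^2\times\mathbb{N}$ with intensity measure $\lambda_2\otimes\mathbb{Q}$ (that is, $d=2$, $\gamma=1$), where $\lambda_2$ is Lebesgue measure; so $\eta$ is a random $\sigma$-finite counting measure such that $\eta(B)$ is Poisson distributed with parameter $(\lambda_2\otimes\mathbb{Q})(B)$ for each measurable $B$ and $\eta(B_1),\dots,\eta(B_n)$ are independent for pairwise disjoint measurable $B_1,\dots,B_n$. For $j\in\mathbb{N}$ put $$K_{2j-1}=\Big[-\tfrac{1}{4(2j-1)},\tfrac{1}{4(2j-1)}\Big]\times[-1,1],\qquad K_{2j}=[-1,1]\times\Big[-\tfrac{1}{4(2j-1)},\tfrac{1}{4(2j-1)}\Big],$$ and for $m\in\mathbb{N}$ let $g_m=\frac u2\mathbf 1_{K_m}$. Let $$Z_u=\Big\{y\in\mathbb{R}^2:\sum_{(x,m)\in\eta}g_m(y-x)\ge u\Big\}$$ be the excursion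 set of the associated Poisson shot noise process. For a polyconvex set $A$ (a finite union of compact convex sets) let $N(A)$ be the smallest number of compact convex sets whose union is $A$. Then $Z_u\cap[0,1]^2$ is almost surely polyconvex, and $$\mathbb{E}\big[2^{N(Z_u\cap[0,1]^2)}\big]=\infty .$$ Hence $Z_u$ is not a standard random set, where a standard random set in $\mathbb{R}^d$ is a stationary random closed set $Z$ such that almost surely $Z\cap K$ is polyconvex for every compact convex $K$, and $\mathbb{E}[2^{N(Z\cap[0,1]^d)}]<\infty$. -/

import Mathlib

open MeasureTheory ProbabilityTheory
open scoped ENNReal NNReal Pointwise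

namespace ShotNoise

/-! ### Poisson processes -/

/-- A `σ`-finite counting measure: a `σ`-finite measure which is a countable sum of Dirac measures
at points that need not be distinct. -/
def IsCountingMeasure {X : Type*} [MeasurableSpace X] (ν : Measure X) : Prop :=
  SigmaFinite ν ∧
    ∃ (ι : Type) (_ : Countable ι) (x : ι → X), ν = Measure.sum fun i => Measure.dirac (x i)

/-- `η` is a Poisson process on `X` with intensity measure `μ`, defined on the probability space
`(Ω, P)`: a random `σ`-finite counting measure such that `η(B)` is Poisson distributed with
parameter `μ(B)` (meaning `η(B) = ∞` almost surely if `μ(B) = ∞`), and such that the values on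
pairwise disjoint measurable sets are independent. -/
structure IsPoissonProcess {Ω X : Type*} [MeasurableSpace Ω] [MeasurableSpace X]
    (η : Ω → Measure X) (μ : Measure X) (P : Measure Ω) : Prop where
  measurable : Measurable η
  counting : ∀ ω, IsCountingMeasure (η ω)
  law : ∀ B, MeasurableSet B → μ B ≠ ∞ →
    HasLaw (fun ω => η ω B)
      ((poissonMeasure (μ B).toNNReal).map (fun n : ℕ => (n : ℝ≥0∞))) P
  law_top : ∀ B, MeasurableSet B → μ B = ∞ → ∀ᵐ ω ∂P, η ω B = ∞
  indep : ∀ (n : ℕ) (B : Fin n → Set X), (∀ i, MeasurableSet (B i)) →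
    Pairwise (fun i j => Disjoint (B i) (B j)) → iIndepFun (fun i ω => η ω (B i)) P

/-! ### Shot noise and excursion sets -/

/-- The shot noise field `f_ν(y) = ∑_{(x, m) ∈ ν} g_m (y - x)`; the sum over the points of the
counting measure `ν` (with multiplicities) is the integral with respect to `ν`. -/
noncomputable def shotNoise {E M : Type*} [AddCommGroup E] [MeasurableSpace E] [MeasurableSpace M]
    (g : M → E → ℝ≥0) (ν : Measure (E × M)) (y : E) : ℝ≥0∞ :=
  ∫⁻ z, (g z.2 (y - z.1) : ℝ≥0∞) ∂ν

/-- The excursion set `{y | f_ν(y) ≥ u}`. -/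
def excursionSet {E M : Type*} [AddCommGroup E] [MeasurableSpace E] [MeasurableSpace M]
    (g : M → E → ℝ≥0) (u : ℝ≥0) (ν : Measure (E × M)) : Set E :=
  {y | (u : ℝ≥0∞) ≤ shotNoise g ν y}

/-! ### Polyconvex sets and standard random sets -/

/-- `A` is a union of `n` compact convex sets. -/
def IsUnionOfConvex {d : ℕ} (A : Set (EuclideanSpace ℝ (Fin d))) (n : ℕ) : Prop :=
  ∃ K : Fin n → Set (EuclideanSpace ℝ (Fin d)),
    (∀ i, IsCompact (K i) ∧ Convex ℝ (K i)) ∧ A = ⋃ i, K i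

/-- `A` is polyconvex: a finite union of compact convex sets. -/
def IsPolyconvex {d : ℕ} (A : Set (EuclideanSpace ℝ (Fin d))) : Prop :=
  ∃ n, IsUnionOfConvex A n

/-- `N(A)`, the smallest `n` such that `A` is a union of `n` compact convex sets (`⊤` if `A` is not
polyconvex, and `N(∅) = 0`). -/
noncomputable def convexNumber {d : ℕ} (A : Set (EuclideanSpace ℝ (Fin d))) : ℕ∞ :=
  ⨅ (n : ℕ) (_ : IsUnionOfConvex A n), (n : ℕ∞)

/-- The unit cube `[0,1]^d`. -/
def unitCube (d : ℕ) : Set (EuclideanSpace ℝ (Fin d)) := {x | ∀ i, x i ∈ Set.Icc (0 : ℝ) 1}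

/-- The expectation of `2 ^ N(Z ∩ [0,1]^d)`. (Mathlib's `∫⁻` is the supremum over measurable minorants,
so the value `∞` means that a measurable minorant has arbitrarily large expectation.) -/
noncomputable def expTwoPow {Ω : Type*} [MeasurableSpace Ω] {d : ℕ} (P : Measure Ω)
    (Z : Ω → Set (EuclideanSpace ℝ (Fin d))) : ℝ≥0∞ :=
  ∫⁻ ω, (((2 : ℕ∞) ^ convexNumber (Z ω ∩ unitCube d) : ℕ∞) : ℝ≥0∞) ∂P

/-- The `σ`-algebra on sets generated by the events `A ∩ U ≠ ∅` with `U` open; restricted to closed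
sets it is the Borel `σ`-algebra of the Fell topology. -/
@[reducible]
def hitMeasurableSpace (d : ℕ) : MeasurableSpace (Set (EuclideanSpace ℝ (Fin d))) :=
  MeasurableSpace.generateFrom
    {S | ∃ U : Set (EuclideanSpace ℝ (Fin d)), IsOpen U ∧ S = {A | (A ∩ U).Nonempty}}

/-- A standard random set: a stationary random closed set with almost surely locally polyconvex
realizations and `𝔼 2 ^ N(Z ∩ [0,1]^d) < ∞`. As usual, a random closed set is considered up to
events of probability zero. -/
structure IsStandardRandomSet {Ω : Type*} [MeasurableSpace Ω] {d : ℕ} (P : Measure Ω)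
    (Z : Ω → Set (EuclideanSpace ℝ (Fin d))) : Prop where
  closed : ∀ᵐ ω ∂P, IsClosed (Z ω)
  measurable : ∀ S, MeasurableSet[hitMeasurableSpace d] S → NullMeasurableSet (Z ⁻¹' S) P
  locallyPolyconvex : ∀ᵐ ω ∂P, ∀ K : Set (EuclideanSpace ℝ (Fin d)),
    IsCompact K → Convex ℝ K → IsPolyconvex (Z ω ∩ K)
  stationary : ∀ (x : EuclideanSpace ℝ (Fin d)) (S : Set (Set (EuclideanSpace ℝ (Fin d)))),
    MeasurableSet[hitMeasurableSpace d] S → P ((fun ω => x +ᵥ Z ω) ⁻¹' S) = P (Z ⁻¹' S)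
  integrable : expTwoPow P Z < ∞

/-! ### The marks and the kernels of the example -/

/-- The `σ`-algebra of all subsets on the mark space `{1, 2, 3, …}`. -/
instance instMeasurableSpaceMarks : MeasurableSpace ℕ+ := ⊤

/-- The geometric distribution on `{1, 2, 3, …}` with mass `(1 - p) p ^ (k - 1)` at `k`. -/
noncomputable def geometricMarks (p : ℝ) : Measure ℕ+ :=
  Measure.sum fun k : ℕ+ => ENNReal.ofReal ((1 - p) * p ^ ((k : ℕ) - 1)) • Measure.dirac k

/-- The thin rectangles
`K_{2j-1} = [-1/(4(2j-1)), 1/(4(2j-1))] × [-1, 1]` and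
`K_{2j} = [-1, 1] × [-1/(4(2j-1)), 1/(4(2j-1))]`. -/
def thinRectangle (m : ℕ+) : Set (EuclideanSpace ℝ (Fin 2)) :=
  if Odd (m : ℕ) then
    {x | |x 0| ≤ 1 / (4 * (m : ℝ)) ∧ |x 1| ≤ 1}
  else
    {x | |x 0| ≤ 1 ∧ |x 1| ≤ 1 / (4 * ((m : ℝ) - 1))}

/-- The kernel `g_m`: equal to `u / 2` on `K_m` and to `0` elsewhere. -/
noncomputable def thinKernel (u : ℝ≥0) (m : ℕ+) : EuclideanSpace ℝ (Fin 2) → ℝ≥0 :=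
  (thinRectangle m).indicator fun _ => u / 2

end ShotNoise

namespace ShotNoise

/-! Every nonzero kernel value is u/2, so the excursion set consists of the points covered by at
least two rectangles, counted with multiplicity. Only points of `coveringWindow` matter for the unit
square. Its intensity is 9, so almost surely there are finitely many of them, and pairwise
intersections of boxes give polyconvexity.

For the infinite expectation, fix n and use only the marks 2n+1 and 2n+2. Suppose there is one
vertical and one horizontal strip near each i/(n+1), 0 ≤ i ≤ n, and no other point in the window
(`IsGrid`). Parallel strips are then disjoint, so the double coverage is an (n+1) × (n+1) array of
crossings separated by gaps. A convex subset cannot meet two crossings, whence N ≥ (n+1)²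
(`IsGrid.le_convexNumber`).

By independence this event has probability at least e⁻⁹ (κ p^(2(n+1))/(n+1))^(2(n+1)) with κ =
e⁻¹(1-p)/4 (`le_measure_isGrid`). The powers of p contribute p^(4(n+1)²), against the gain
2^((n+1)²). Since 2p⁴ > 1, the product (2p⁴)^((n+1)²) beats the remaining factor, which is only of
order exp(-O(n log n)). -/

instance : MeasurableSingletonClass ℕ+ := ⟨fun _ => trivial⟩

/-! ### Excursion as double coverage -/

/-- The set of marked points `(x, m)` whose rectangle `x + K_m` covers `y`. -/
def coveringPoints (y : EuclideanSpace ℝ (Fin 2)) : Set (EuclideanSpace ℝ (Fin 2) × ℕ+) :=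
  {z | y - z.1 ∈ thinRectangle z.2}

lemma shotNoise_thinKernel {ν : Measure (EuclideanSpace ℝ (Fin 2) × ℕ+)}
    (hν : IsCountingMeasure ν) (u : ℝ≥0) (y : EuclideanSpace ℝ (Fin 2)) :
    shotNoise (thinKernel u) ν y = ((u / 2 : ℝ≥0) : ℝ≥0∞) * ν (coveringPoints y) := by
  obtain ⟨-, ι, _, x, rfl⟩ := hν
  rw [shotNoise, lintegral_sum_measure, Measure.sum_apply_of_countable, ← ENNReal.tsum_mul_left]
  refine tsum_congr fun i => ?_
  rw [lintegral_dirac, Measure.dirac_apply]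
  by_cases h : y - (x i).1 ∈ thinRectangle (x i).2
  · simp [thinKernel, coveringPoints, h]
  · simp [thinKernel, coveringPoints, h]

lemma mem_excursionSet_thinKernel {ν : Measure (EuclideanSpace ℝ (Fin 2) × ℕ+)}
    (hν : IsCountingMeasure ν) {u : ℝ≥0} (hu : 0 < u) (y : EuclideanSpace ℝ (Fin 2)) :
    y ∈ excursionSet (thinKernel u) u ν ↔ 2 ≤ ν (coveringPoints y) := by
  have h0 : ((u / 2 : ℝ≥0) : ℝ≥0∞) ≠ 0 := by
    rw [ENNReal.coe_ne_zero]; positivity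
  have h2 : (u : ℝ≥0∞) = ((u / 2 : ℝ≥0) : ℝ≥0∞) * 2 := by
    rw [← ENNReal.coe_ofNat, ← ENNReal.coe_mul]
    congr 1
    field_simp
  rw [excursionSet, Set.mem_ofPred_eq, shotNoise_thinKernel hν]
  nth_rewrite 1 [h2]
  exact ENNReal.mul_le_mul_iff_right h0 ENNReal.coe_ne_top

lemma two_le_sum_dirac_iff {X ι : Type*} [MeasurableSpace X] [MeasurableSingletonClass X]
    [Countable ι] (x : ι → X) (S : Set X) :
    2 ≤ Measure.sum (fun i => Measure.dirac (x i)) S ↔ ∃ i k, i ≠ k ∧ x i ∈ S ∧ x k ∈ S := by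
  classical
  have key : Measure.sum (fun i => Measure.dirac (x i)) S
      = ∑' i, S.indicator (1 : X → ℝ≥0∞) (x i) := by
    rw [Measure.sum_apply_of_countable]
    exact tsum_congr fun i => Measure.dirac_apply _ _
  rw [key]
  constructor
  · intro h
    by_contra! hc
    by_cases hne : ∃ i, x i ∈ S
    · obtain ⟨i, hi⟩ := hne
      rw [tsum_eq_single i] at h
      · simp [hi] at h
      · intro k hk
        exact Set.indicator_of_notMem (hc i k hk.symm hi) _
    · push Not at hne
      simp [hne] at h
  · rintro ⟨i, k, hik, hi, hk⟩
    refine le_trans ?_ (ENNReal.sum_le_tsum {i, k})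
    rw [Finset.sum_pair hik]
    simp [hi, hk, one_add_one_eq_two]

lemma finite_of_sum_dirac_ne_top {X ι : Type*} [MeasurableSpace X] [MeasurableSingletonClass X]
    [Countable ι] (x : ι → X) (S : Set X)
    (h : Measure.sum (fun i => Measure.dirac (x i)) S ≠ ∞) : {i | x i ∈ S}.Finite := by
  rw [Measure.sum_apply_of_countable] at h
  refine (ENNReal.finite_const_le_of_tsum_ne_top h one_ne_zero).subset fun i hi => ?_
  simp only [Set.mem_ofPred_eq] at hi ⊢
  simp [hi]

/-! ### Coordinate boxes and polyconvexity -/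

/-- The axis-parallel box with lower corner `l` and upper corner `r`. -/
def coordBox {d : ℕ} (l r : Fin d → ℝ) : Set (EuclideanSpace ℝ (Fin d)) :=
  {x | ∀ c, x c ∈ Set.Icc (l c) (r c)}

lemma coordBox_eq_preimage {d : ℕ} (l r : Fin d → ℝ) :
    coordBox l r = (WithLp.ofLp : EuclideanSpace ℝ (Fin d) → Fin d → ℝ) ⁻¹'
      Set.univ.pi fun c => Set.Icc (l c) (r c) := by
  ext x
  simp only [coordBox, Set.mem_ofPred_eq, Set.mem_preimage, Set.mem_univ_pi]

lemma measurableSet_coordBox {d : ℕ} (l r : Fin d → ℝ) : MeasurableSet (coordBox l r) := by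
  rw [coordBox_eq_preimage]
  exact (PiLp.volume_preserving_ofLp (Fin d)).measurable
    (MeasurableSet.univ_pi fun _ => measurableSet_Icc)

lemma volume_coordBox {d : ℕ} (l r : Fin d → ℝ) :
    volume (coordBox l r) = ∏ c, ENNReal.ofReal (r c - l c) := by
  rw [coordBox_eq_preimage, (PiLp.volume_preserving_ofLp (Fin d)).measure_preimage
    (MeasurableSet.univ_pi fun _ => measurableSet_Icc).nullMeasurableSet, volume_pi_pi]
  simp

lemma convex_coordBox {d : ℕ} (l r : Fin d → ℝ) : Convex ℝ (coordBox l r) := by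
  rw [coordBox_eq_preimage]
  exact (convex_pi fun _ _ => convex_Icc _ _).linear_preimage
    (WithLp.linearEquiv 2 ℝ (Fin d → ℝ)).toLinearMap

lemma isCompact_coordBox {d : ℕ} (l r : Fin d → ℝ) : IsCompact (coordBox l r) := by
  rw [coordBox_eq_preimage]
  exact (PiLp.homeomorph 2 fun _ : Fin d => ℝ).isCompact_preimage.2
    (isCompact_univ_pi fun _ => isCompact_Icc)

lemma unitCube_eq_coordBox (d : ℕ) : unitCube d = coordBox 0 1 := rfl

/-- The half side lengths of `K_m`. -/
noncomputable def thinRadius (m : ℕ+) : Fin 2 → ℝ :=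
  if Odd (m : ℕ) then ![1 / (4 * (m : ℝ)), 1] else ![1, 1 / (4 * ((m : ℝ) - 1))]

lemma thinRectangle_eq (m : ℕ+) : thinRectangle m = {x | ∀ c, |x c| ≤ thinRadius m c} := by
  unfold thinRectangle thinRadius
  split_ifs <;> ext x <;> simp [Fin.forall_fin_two]

lemma thinRadius_le_one (m : ℕ+) (c : Fin 2) : thinRadius m c ≤ 1 := by
  have hm : (1 : ℝ) ≤ m := by exact_mod_cast m.pos
  unfold thinRadius
  split_ifs with h
  · fin_cases c
    · change 1 / (4 * (m : ℝ)) ≤ 1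
      rw [div_le_one (by positivity)]; linarith
    · exact le_rfl
  · have : (2 : ℝ) ≤ m := by
      have : 2 ≤ (m : ℕ) := by
        have := m.pos
        rcases Nat.lt_or_ge (m : ℕ) 2 with h2 | h2
        · exact absurd (by rw [show (m : ℕ) = 1 by lia]; exact odd_one) h
        · exact h2
      exact_mod_cast this
    fin_cases c
    · exact le_rfl
    · change 1 / (4 * ((m : ℝ) - 1)) ≤ 1
      rw [div_le_one (by linarith)]; linarith

lemma setOf_mem_coveringPoints (z : EuclideanSpace ℝ (Fin 2) × ℕ+) :
    {y | z ∈ coveringPoints y} =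
      coordBox (fun c => z.1 c - thinRadius z.2 c) (fun c => z.1 c + thinRadius z.2 c) := by
  ext y
  simp only [coveringPoints, thinRectangle_eq, Set.mem_ofPred_eq, coordBox, PiLp.sub_apply,
    Set.mem_Icc, abs_le]
  exact forall_congr' fun c => by constructor <;> rintro ⟨h1, h2⟩ <;> constructor <;> linarith

/-- The marked points that can cover a point of the unit square. -/
def coveringWindow : Set (EuclideanSpace ℝ (Fin 2) × ℕ+) :=
  coordBox (fun _ => -1) (fun _ => 2) ×ˢ Set.univ

lemma coveringPoints_subset {y : EuclideanSpace ℝ (Fin 2)} (hy : y ∈ unitCube 2) :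
    coveringPoints y ⊆ coveringWindow := by
  intro z hz
  refine ⟨fun c => ?_, trivial⟩
  simp only [coveringPoints, thinRectangle_eq, Set.mem_ofPred_eq, PiLp.sub_apply] at hz
  have h1 := abs_le.1 ((hz c).trans (thinRadius_le_one _ c))
  have h2 := hy c
  constructor <;> linarith [h1.1, h1.2, h2.1, h2.2]

lemma isPolyconvex_excursionSet {ν : Measure (EuclideanSpace ℝ (Fin 2) × ℕ+)}
    (hν : IsCountingMeasure ν) (hfin : ν coveringWindow ≠ ∞) {u : ℝ≥0} (hu : 0 < u) :
    IsPolyconvex (excursionSet (thinKernel u) u ν ∩ unitCube 2) := by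
  have hmem := mem_excursionSet_thinKernel hν hu
  obtain ⟨-, ι, _, x, rfl⟩ := hν
  have hI := finite_of_sum_dirac_ne_top x _ hfin
  -- Pairs of indices rather than of points, so that a point of multiplicity two is also accounted
  -- for.
  have hJ : {q : ι × ι | q.1 ≠ q.2 ∧ x q.1 ∈ coveringWindow ∧ x q.2 ∈ coveringWindow}.Finite :=
    (hI.prod hI).subset fun q hq => ⟨hq.2.1, hq.2.2⟩
  have := hJ.fintype
  let e := Fintype.equivFin
    {q : ι × ι | q.1 ≠ q.2 ∧ x q.1 ∈ coveringWindow ∧ x q.2 ∈ coveringWindow}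
  refine ⟨_, fun k => {y | x (e.symm k).1.1 ∈ coveringPoints y} ∩
    ({y | x (e.symm k).1.2 ∈ coveringPoints y} ∩ unitCube 2), fun k => ?_, ?_⟩
  · beta_reduce
    rw [setOf_mem_coveringPoints, setOf_mem_coveringPoints, unitCube_eq_coordBox]
    exact ⟨(isCompact_coordBox _ _).inter ((isCompact_coordBox _ _).inter (isCompact_coordBox _ _)),
      (convex_coordBox _ _).inter ((convex_coordBox _ _).inter (convex_coordBox _ _))⟩
  · ext y
    simp only [Set.mem_inter_iff, Set.mem_iUnion, hmem, two_le_sum_dirac_iff]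
    constructor
    · rintro ⟨⟨i, k, hik, hi, hk⟩, hy⟩
      refine ⟨e ⟨(i, k), hik, coveringPoints_subset hy hi, coveringPoints_subset hy hk⟩, ?_⟩
      simpa using ⟨hi, hk, hy⟩
    · rintro ⟨k, h1, h2, hy⟩
      exact ⟨⟨_, _, (e.symm k).2.1, h1, h2⟩, hy⟩

/-! ### Strips and their cells -/

/-- The mark `2n + 1` of the vertical strips (`c = 0`) and the mark `2n + 2` of the horizontal
strips (`c = 1`) of half width `1 / (4 (2n + 1))`. -/
def stripMark (n : ℕ) (c : Fin 2) : ℕ+ := ⟨2 * n + 1 + c, by lia⟩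

lemma stripMark_injective (n : ℕ) : Function.Injective (stripMark n) := by
  intro c c' h
  have := congrArg PNat.val h
  simp only [stripMark, PNat.mk_coe] at this
  lia

lemma thinRadius_stripMark (n : ℕ) (c a : Fin 2) :
    thinRadius (stripMark n c) a = if a = c then 1 / (4 * (2 * (n : ℝ) + 1)) else 1 := by
  fin_cases c
  · fin_cases a <;> simp [thinRadius, stripMark]
  · have : ¬ Odd ((stripMark n 1 : ℕ+) : ℕ) := by
      rw [Nat.not_odd_iff_even]; exact ⟨n + 1, by simp [stripMark]; ring⟩
    simp only [Fin.mk_one, thinRadius, if_neg this]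
    fin_cases a <;> simp [stripMark]

/-- The positions and the marks of the `i`-th strip perpendicular to the axis `c`. -/
noncomputable def stripCell (n : ℕ) (k : Fin 2 × Fin (n + 1)) :
    Set (EuclideanSpace ℝ (Fin 2) × ℕ+) :=
  coordBox (fun a => if a = k.1 then (k.2 : ℝ) / (n + 1) else 0)
    (fun a => if a = k.1 then ((k.2 : ℝ) + 1 / 4) / (n + 1) else 1) ×ˢ {stripMark n k.1}

lemma measurableSet_stripCell (n : ℕ) (k : Fin 2 × Fin (n + 1)) :
    MeasurableSet (stripCell n k) :=
  (measurableSet_coordBox _ _).prod (measurableSet_singleton _)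

lemma coord_of_mem_stripCell {n : ℕ} {k : Fin 2 × Fin (n + 1)}
    {z : EuclideanSpace ℝ (Fin 2) × ℕ+} (hz : z ∈ stripCell n k) :
    (k.2 : ℝ) ≤ (n + 1) * z.1 k.1 ∧ (n + 1) * z.1 k.1 ≤ k.2 + 1 / 4 := by
  have h := hz.1 k.1
  simp only [if_true, Set.mem_Icc] at h
  have hn : (0 : ℝ) < n + 1 := by positivity
  rw [div_le_iff₀ hn, le_div_iff₀ hn] at h
  constructor <;> linarith [h.1, h.2]

lemma mem_Icc_of_mem_stripCell {n : ℕ} {k : Fin 2 × Fin (n + 1)}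
    {z : EuclideanSpace ℝ (Fin 2) × ℕ+} (hz : z ∈ stripCell n k) (a : Fin 2) :
    z.1 a ∈ Set.Icc (0 : ℝ) 1 := by
  by_cases hak : a = k.1
  · subst hak
    have h := coord_of_mem_stripCell hz
    have hk : (k.2 : ℝ) ≤ n := by exact_mod_cast Nat.lt_succ_iff.1 k.2.2
    have hk0 : (0 : ℝ) ≤ k.2 := by positivity
    have hn : (0 : ℝ) < n + 1 := by positivity
    constructor
    · exact nonneg_of_mul_nonneg_right (hk0.trans h.1) hn
    · exact le_of_mul_le_mul_left (by linarith [h.2]) hn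
  · have h := hz.1 a
    simpa [hak] using h

lemma stripCell_subset (n : ℕ) (k : Fin 2 × Fin (n + 1)) : stripCell n k ⊆ coveringWindow := by
  intro z hz
  refine ⟨fun a => ?_, trivial⟩
  have h := mem_Icc_of_mem_stripCell hz a
  constructor <;> linarith [h.1, h.2]

/-- In units of 1/(n+1) the centre lies in [i, i + 1/4], and the half width is at most 1/4 because n
+ 1 ≤ 2n + 1. Consecutive parallel strips thus leave the gap (i + 1/2, i + 3/4) free. -/
lemma coord_of_mem_stripCell_of_mem_coveringPoints {n : ℕ} {k : Fin 2 × Fin (n + 1)}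
    {z : EuclideanSpace ℝ (Fin 2) × ℕ+} (hz : z ∈ stripCell n k)
    {y : EuclideanSpace ℝ (Fin 2)} (hy : z ∈ coveringPoints y) :
    (k.2 : ℝ) - 1 / 4 ≤ (n + 1) * y k.1 ∧ (n + 1) * y k.1 ≤ k.2 + 1 / 2 := by
  have h := coord_of_mem_stripCell hz
  have hm : z.2 = stripMark n k.1 := hz.2
  simp only [coveringPoints, thinRectangle_eq, Set.mem_ofPred_eq, PiLp.sub_apply] at hy
  have h1 := hy k.1
  rw [hm, thinRadius_stripMark, if_pos rfl] at h1
  have hn : (0 : ℝ) < n + 1 := by positivity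
  have h2 : 1 / (4 * (2 * (n : ℝ) + 1)) ≤ 1 / (4 * (n + 1)) := by
    apply one_div_le_one_div_of_le (by positivity); linarith [(Nat.cast_nonneg n : (0 : ℝ) ≤ n)]
  have h3 : (n + 1) * (1 / (4 * ((n : ℝ) + 1))) = 1 / 4 := by field_simp
  have h4 := abs_le.1 (h1.trans h2)
  have h5 := mul_le_mul_of_nonneg_left h4.1 hn.le
  have h6 := mul_le_mul_of_nonneg_left h4.2 hn.le
  rw [mul_neg, h3] at h5
  rw [h3] at h6
  constructor <;> linarith [h.1, h.2]

lemma fin_eq_of_coord_close {n : ℕ} {i k : Fin (n + 1)} {t : ℝ}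
    (hi : (i : ℝ) - 1 / 4 ≤ t ∧ t ≤ i + 1 / 2) (hk : (k : ℝ) - 1 / 4 ≤ t ∧ t ≤ k + 1 / 2) :
    i = k := by
  have h1 : (i : ℝ) < (k : ℕ) + 1 := by linarith [hi.1, hk.2]
  have h2 : (k : ℝ) < (i : ℕ) + 1 := by linarith [hk.1, hi.2]
  have h1' : (i : ℕ) < k + 1 := by exact_mod_cast h1
  have h2' : (k : ℕ) < i + 1 := by exact_mod_cast h2
  ext; lia

lemma disjoint_stripCell {n : ℕ} {k l : Fin 2 × Fin (n + 1)} (hkl : k ≠ l) :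
    Disjoint (stripCell n k) (stripCell n l) := by
  rw [Set.disjoint_left]
  intro z hk hl
  have hc : k.1 = l.1 := stripMark_injective n ((show z.2 = _ from hk.2).symm.trans hl.2)
  refine hkl (Prod.ext hc ?_)
  have h1 := coord_of_mem_stripCell hk
  have h2 := coord_of_mem_stripCell hl
  rw [← hc] at h2
  exact fin_eq_of_coord_close (t := (n + 1) * z.1 k.1)
    ⟨by linarith [h1.1], by linarith [h1.2]⟩ ⟨by linarith [h2.1], by linarith [h2.2]⟩

/-! ### Grid configurations and the number of convex pieces -/

/-- The part of the covering window outside of all strip cells. -/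
noncomputable def stripComplement (n : ℕ) : Set (EuclideanSpace ℝ (Fin 2) × ℕ+) :=
  coveringWindow \ ⋃ k, stripCell n k

/-- The configurations with exactly one point in every strip cell and no other point in the covering
window. -/
structure IsGrid (n : ℕ) (ν : Measure (EuclideanSpace ℝ (Fin 2) × ℕ+)) : Prop where
  cell : ∀ k, ν (stripCell n k) = 1
  rest : ν (stripComplement n) = 0

/-- If coordinate `c` of `y` lies in a gap, no strip perpendicular to `c` reaches `y`. The strips
perpendicular to the other axis are pairwise disjoint, so at most one point covers `y`. -/
lemma IsGrid.exists_coord {n : ℕ} {ν : Measure (EuclideanSpace ℝ (Fin 2) × ℕ+)} (h : IsGrid n ν)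
    {y : EuclideanSpace ℝ (Fin 2)} (hy : y ∈ unitCube 2) (h2 : 2 ≤ ν (coveringPoints y))
    (c : Fin 2) : ∃ i : Fin (n + 1), (i : ℝ) - 1 / 4 ≤ (n + 1) * y c ∧
      (n + 1) * y c ≤ i + 1 / 2 := by
  by_contra! hc
  have hsub : ∃ k : Fin 2 × Fin (n + 1), coveringPoints y ⊆ stripComplement n ∪ stripCell n k := by
    by_cases hex : ∃ z k, z ∈ coveringPoints y ∧ z ∈ stripCell n k
    · obtain ⟨z, k, hz, hk⟩ := hex
      refine ⟨k, fun w hw => ?_⟩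
      by_cases hwk : ∃ l, w ∈ stripCell n l
      · obtain ⟨l, hl⟩ := hwk
        have e1 := coord_of_mem_stripCell_of_mem_coveringPoints hk hz
        have e2 := coord_of_mem_stripCell_of_mem_coveringPoints hl hw
        have n1 : k.1 ≠ c := by
          rintro rfl; exact absurd e1.2 (not_le.2 (hc _ e1.1))
        have n2 : l.1 ≠ c := by
          rintro rfl; exact absurd e2.2 (not_le.2 (hc _ e2.1))
        have hkl : k.1 = l.1 := by lia
        rw [← hkl] at e2
        have : k = l := Prod.ext hkl (fin_eq_of_coord_close e1 e2)
        exact Or.inr (this ▸ hl)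
      · exact Or.inl ⟨coveringPoints_subset hy hw, by simpa using hwk⟩
    · push Not at hex
      exact ⟨0, fun w hw => Or.inl ⟨coveringPoints_subset hy hw, by simpa using fun c i => hex w (c, i) hw⟩⟩
  obtain ⟨k, hk⟩ := hsub
  have := calc (2 : ℝ≥0∞) ≤ ν (coveringPoints y) := h2
    _ ≤ ν (stripComplement n ∪ stripCell n k) := measure_mono hk
    _ ≤ ν (stripComplement n) + ν (stripCell n k) := measure_union_le _ _
    _ = 1 := by rw [h.rest, h.cell, zero_add]
  exact absurd this (by norm_num)

lemma IsCountingMeasure.exists_mem_of_ne_zero {X : Type*} [MeasurableSpace X]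
    [MeasurableSingletonClass X] {ν : Measure X} (hν : IsCountingMeasure ν) {S : Set X}
    (hS : ν S ≠ 0) : ∃ z ∈ S, 1 ≤ ν {z} := by
  obtain ⟨-, ι, _, x, rfl⟩ := hν
  rw [Measure.sum_apply_of_countable, ne_eq, ENNReal.tsum_eq_zero] at hS
  push Not at hS
  obtain ⟨i, hi⟩ := hS
  refine ⟨x i, ?_, ?_⟩
  · by_contra hc
    simp [hc] at hi
  · rw [Measure.sum_apply_of_countable]
    refine le_trans ?_ (ENNReal.le_tsum i)
    simp

/-- The crossing `q s` takes coordinate `c` from the centre of the strip in cell `(c, s c)`. A strip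
has half length 1 and its centre lies in the unit square, so it spans the square lengthwise and
contains the crossing. -/
lemma IsGrid.exists_crossings {n : ℕ} {ν : Measure (EuclideanSpace ℝ (Fin 2) × ℕ+)}
    (h : IsGrid n ν) (hν : IsCountingMeasure ν) :
    ∃ q : (Fin 2 → Fin (n + 1)) → EuclideanSpace ℝ (Fin 2), ∀ s,
      (q s ∈ unitCube 2 ∧ 2 ≤ ν (coveringPoints (q s))) ∧
      ∀ c, (s c : ℝ) ≤ (n + 1) * q s c ∧ (n + 1) * q s c ≤ s c + 1 / 4 := by
  choose x hx hx1 using fun k => hν.exists_mem_of_ne_zero (S := stripCell n k) (by simp [h.cell k])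
  refine ⟨fun s => WithLp.toLp 2 fun c => (x (c, s c)).1 c, fun s => ⟨⟨fun c => ?_, ?_⟩, fun c => ?_⟩⟩
  · exact mem_Icc_of_mem_stripCell (hx (c, s c)) c
  · have hcov : ∀ a, x (a, s a) ∈
        coveringPoints (WithLp.toLp 2 fun c => (x (c, s c)).1 c : EuclideanSpace ℝ (Fin 2)) := by
      intro a
      have hm : (x (a, s a)).2 = stripMark n a := (hx (a, s a)).2
      simp only [coveringPoints, thinRectangle_eq, Set.mem_ofPred_eq, PiLp.sub_apply, hm,
        thinRadius_stripMark]
      intro c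
      split_ifs with hca
      · subst hca
        simp only [sub_self, abs_zero]
        positivity
      · have h1 := mem_Icc_of_mem_stripCell (hx (a, s a)) c
        have h2 := mem_Icc_of_mem_stripCell (hx (c, s c)) c
        rw [abs_le]
        constructor <;> linarith [h1.1, h1.2, h2.1, h2.2]
    -- The marks differ, so the two atoms are distinct and their masses add up.
    have hne : x (0, s 0) ≠ x (1, s 1) := fun he => by
      have h0 : (x (0, s 0)).2 = stripMark n 0 := (hx (0, s 0)).2
      have h1 : (x (1, s 1)).2 = stripMark n 1 := (hx (1, s 1)).2
      rw [he, h1] at h0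
      exact absurd (stripMark_injective n h0) (by decide)
    calc (2 : ℝ≥0∞) = 1 + 1 := one_add_one_eq_two.symm
      _ ≤ ν {x (0, s 0)} + ν {x (1, s 1)} := add_le_add (hx1 _) (hx1 _)
      _ = ν ({x (0, s 0)} ∪ {x (1, s 1)}) :=
        (measure_union (by simpa using hne) (measurableSet_singleton _)).symm
      _ ≤ _ := measure_mono (by
        rintro z (rfl | rfl)
        · exact hcov 0
        · exact hcov 1)
  · exact coord_of_mem_stripCell (hx (c, s c))

/-- The projection of a convex set to a coordinate axis is an interval, so a convex set meeting two
different columns or rows would contain a point over the gap between them. Applied in both orders,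
this forces equal indices. -/
lemma IsGrid.eq_of_convex {n : ℕ} {ν : Measure (EuclideanSpace ℝ (Fin 2) × ℕ+)}
    (h : IsGrid n ν) {C : Set (EuclideanSpace ℝ (Fin 2))} (hC : Convex ℝ C)
    (hsub : ∀ y ∈ C, y ∈ unitCube 2 ∧ 2 ≤ ν (coveringPoints y))
    {y z : EuclideanSpace ℝ (Fin 2)} (hy : y ∈ C) (hz : z ∈ C) {c : Fin 2} {i k : Fin (n + 1)}
    (hyi : (i : ℝ) ≤ (n + 1) * y c ∧ (n + 1) * y c ≤ i + 1 / 4)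
    (hzk : (k : ℝ) ≤ (n + 1) * z c ∧ (n + 1) * z c ≤ k + 1 / 4) : ¬ i < k := by
  intro hik
  have hik' : (i : ℝ) + 1 ≤ (k : ℕ) := by exact_mod_cast hik
  let f : EuclideanSpace ℝ (Fin 2) →ₗ[ℝ] ℝ := (EuclideanSpace.proj c).toLinearMap
  have hf : ∀ w, f w = w c := fun _ => rfl
  have hn : (0 : ℝ) < n + 1 := by positivity
  -- 5/8 is the midpoint of the gap (1/2, 3/4).
  have hmem : ((i : ℝ) + 5 / 8) / (n + 1) ∈ f '' C := by
    refine (hC.linear_image f).ordConnected.out (Set.mem_image_of_mem f hy)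
      (Set.mem_image_of_mem f hz) ⟨?_, ?_⟩
    · rw [hf, le_div_iff₀ hn]; linarith [hyi.2]
    · rw [hf, div_le_iff₀ hn]; linarith [hzk.1]
  obtain ⟨w, hw, hwt⟩ := hmem
  obtain ⟨l, hl⟩ := h.exists_coord (hsub w hw).1 (hsub w hw).2 c
  rw [← hf, hwt, mul_div_cancel₀ _ hn.ne'] at hl
  have h1 : (l : ℝ) < (i : ℕ) + 1 := by linarith [hl.1]
  have h2 : (i : ℝ) < (l : ℕ) := by linarith [hl.2]
  have h1' : (l : ℕ) < i + 1 := by exact_mod_cast h1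
  have h2' : (i : ℕ) < l := by exact_mod_cast h2
  lia

/-- Pigeonhole: sending each crossing to a convex piece containing it is injective. -/
lemma IsGrid.le_convexNumber {n : ℕ} {ν : Measure (EuclideanSpace ℝ (Fin 2) × ℕ+)}
    (h : IsGrid n ν) (hν : IsCountingMeasure ν) {u : ℝ≥0} (hu : 0 < u) :
    (((n + 1) ^ 2 : ℕ) : ℕ∞) ≤
      convexNumber (excursionSet (thinKernel u) u ν ∩ unitCube 2) := by
  refine le_iInf₂ fun N hN => ?_
  obtain ⟨K, hK, hA⟩ := hN
  obtain ⟨q, hq⟩ := h.exists_crossings hν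
  have hiff : ∀ y, (∃ j, y ∈ K j) ↔ y ∈ unitCube 2 ∧ 2 ≤ ν (coveringPoints y) := by
    intro y
    rw [← Set.mem_iUnion, ← hA, Set.mem_inter_iff, mem_excursionSet_thinKernel hν hu, and_comm]
  choose f hf using fun s => (hiff (q s)).2 (hq s).1
  have hinj : Function.Injective f := by
    intro s t hst
    have ht := hf t
    rw [← hst] at ht
    have hsub : ∀ y ∈ K (f s), y ∈ unitCube 2 ∧ 2 ≤ ν (coveringPoints y) :=
      fun y hy => (hiff y).1 ⟨_, hy⟩
    funext c
    exact le_antisymm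
      (not_lt.1 (h.eq_of_convex (hK _).2 hsub ht (hf s) ((hq t).2 c) ((hq s).2 c)))
      (not_lt.1 (h.eq_of_convex (hK _).2 hsub (hf s) ht ((hq s).2 c) ((hq t).2 c)))
  have := Fintype.card_le_of_injective f hinj
  simp only [Fintype.card_fin, Fintype.card_fun] at this
  exact_mod_cast this

/-! ### Probability of the grid event -/

lemma geometricMarks_singleton (p : ℝ) (k : ℕ+) :
    geometricMarks p {k} = ENNReal.ofReal ((1 - p) * p ^ ((k : ℕ) - 1)) :=
  Measure.sum_smul_dirac_singleton

lemma isProbabilityMeasure_geometricMarks {p : ℝ} (hp0 : 0 ≤ p) (hp1 : p < 1) :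
    IsProbabilityMeasure (geometricMarks p) := by
  constructor
  rw [geometricMarks, Measure.sum_apply_of_countable]
  simp only [Measure.smul_apply, measure_univ, smul_eq_mul, mul_one]
  rw [tsum_pnat_eq_tsum_succ (f := fun k : ℕ => ENNReal.ofReal ((1 - p) * p ^ (k - 1)))]
  simp only [Nat.add_sub_cancel]
  have h1 : 0 ≤ 1 - p := by linarith
  rw [← ENNReal.ofReal_tsum_of_nonneg (fun n => by positivity)
    ((summable_geometric_of_lt_one hp0 hp1).mul_left _), tsum_mul_left,
    tsum_geometric_of_lt_one hp0 hp1, mul_inv_cancel₀ (by linarith), ENNReal.ofReal_one]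

namespace IsPoissonProcess

variable {Ω X : Type*} [MeasurableSpace Ω] [MeasurableSpace X]
  {η : Ω → Measure X} {μ : Measure X} {P : Measure Ω}

lemma measure_eq_natCast (hη : IsPoissonProcess η μ P) {B : Set X} (hB : MeasurableSet B)
    (hfin : μ B ≠ ∞) (k : ℕ) : P {ω | η ω B = k} = poissonMeasure (μ B).toNNReal {k} := by
  have hk : MeasurableSet {t : ℝ≥0∞ | t = k} := measurableSet_singleton _
  rw [(hη.law B hB hfin).measure_eq hk, Measure.map_apply .of_discrete hk]
  congr 1
  ext m
  simp

lemma ae_ne_top (hη : IsPoissonProcess η μ P) {B : Set X} (hB : MeasurableSet B)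
    (hfin : μ B ≠ ∞) : ∀ᵐ ω ∂P, η ω B ≠ ∞ := by
  have htop : MeasurableSet {t : ℝ≥0∞ | t = ∞} := measurableSet_singleton _
  simp only [ae_iff, ne_eq, not_not]
  rw [(hη.law B hB hfin).measure_eq htop, Measure.map_apply .of_discrete htop]
  simp [Set.preimage]

lemma measure_forall_eq (hη : IsPoissonProcess η μ P) {ι : Type*} [Fintype ι] (B : ι → Set X)
    (hB : ∀ i, MeasurableSet (B i)) (hd : Pairwise fun i j => Disjoint (B i) (B j))
    (hfin : ∀ i, μ (B i) ≠ ∞) (k : ι → ℕ) :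
    P {ω | ∀ i, η ω (B i) = k i} = ∏ i, poissonMeasure (μ (B i)).toNNReal {k i} := by
  let e := Fintype.equivFin ι
  have hi : iIndepFun (fun i ω => η ω (B i)) P := by
    have := (hη.indep _ (fun j => B (e.symm j)) (fun j => hB _)
      fun a b hab => hd (e.symm.injective.ne hab)).precomp e.injective
    simpa using this
  have := hi.measure_inter_preimage_eq_mul Finset.univ
    (sets := fun i => {(k i : ℝ≥0∞)}) fun i _ => measurableSet_singleton _
  have hset : {ω | ∀ i, η ω (B i) = k i} =
      ⋂ i ∈ (Finset.univ : Finset ι), (fun ω => η ω (B i)) ⁻¹' {(k i : ℝ≥0∞)} := by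
    ext ω; simp
  rw [hset, this]
  exact Finset.prod_congr rfl fun i _ => hη.measure_eq_natCast (hB i) (hfin i) (k i)

end IsPoissonProcess

lemma volume_prod_stripCell {p : ℝ} (hp0 : 0 ≤ p) (hp1 : p < 1) (n : ℕ)
    (k : Fin 2 × Fin (n + 1)) :
    ((volume : Measure (EuclideanSpace ℝ (Fin 2))).prod (geometricMarks p)) (stripCell n k) =
      ENNReal.ofReal (1 / (4 * (n + 1)) * ((1 - p) * p ^ (2 * n + (k.1 : ℕ)))) := by
  have := isProbabilityMeasure_geometricMarks hp0 hp1
  have hn : (0 : ℝ) < n + 1 := by positivity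
  have hw : ((k.2 : ℝ) + 1 / 4) / (n + 1) - k.2 / (n + 1) = 1 / (4 * (n + 1)) := by
    field_simp; ring
  rw [stripCell, Measure.prod_prod, volume_coordBox, geometricMarks_singleton,
    ENNReal.ofReal_mul (p := 1 / (4 * ((n : ℝ) + 1))) (by positivity)]
  congr 1
  · obtain ⟨c, i⟩ := k
    rw [← hw, Fin.prod_univ_two]
    fin_cases c <;> simp
  · congr 3
    simp only [stripMark, PNat.mk_coe]
    lia

lemma volume_prod_coveringWindow {p : ℝ} (hp0 : 0 ≤ p) (hp1 : p < 1) :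
    ((volume : Measure (EuclideanSpace ℝ (Fin 2))).prod (geometricMarks p)) coveringWindow = 9 := by
  have := isProbabilityMeasure_geometricMarks hp0 hp1
  rw [coveringWindow, Measure.prod_prod, volume_coordBox, measure_univ, mul_one,
    Fin.prod_univ_two, ← ENNReal.ofReal_mul (by norm_num)]
  norm_num

lemma measurableSet_coveringWindow : MeasurableSet coveringWindow :=
  (measurableSet_coordBox _ _).prod .univ

/-- The strip cells together with the complement. -/
noncomputable def gridCell (n : ℕ) : Option (Fin 2 × Fin (n + 1)) →
    Set (EuclideanSpace ℝ (Fin 2) × ℕ+)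
  | none => stripComplement n
  | some k => stripCell n k

lemma measurableSet_gridCell (n : ℕ) : ∀ o, MeasurableSet (gridCell n o)
  | none => measurableSet_coveringWindow.diff (.iUnion fun k => measurableSet_stripCell n k)
  | some k => measurableSet_stripCell n k

lemma gridCell_subset (n : ℕ) : ∀ o, gridCell n o ⊆ coveringWindow
  | none => Set.sdiff_subset
  | some k => stripCell_subset n k

lemma pairwise_disjoint_gridCell (n : ℕ) :
    Pairwise fun i j => Disjoint (gridCell n i) (gridCell n j) := by
  have h : ∀ k, Disjoint (stripCell n k) (stripComplement n) := fun k =>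
    (Set.disjoint_sdiff_right (s := ⋃ k, stripCell n k)).mono_left (Set.subset_iUnion _ k)
  rintro (_ | k) (_ | l) hkl
  · exact absurd rfl hkl
  · exact (h l).symm
  · exact h k
  · exact disjoint_stripCell fun e => hkl (congrArg _ e)

/-- Expresses the event by prescribed counts on one finite disjoint family, the form to which
independence applies. -/
lemma isGrid_iff {n : ℕ} {ν : Measure (EuclideanSpace ℝ (Fin 2) × ℕ+)} :
    IsGrid n ν ↔ ∀ o, ν (gridCell n o) = ((if o = none then 0 else 1 : ℕ) : ℝ≥0∞) := by
  constructor
  · rintro ⟨h1, h2⟩ (_ | k)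
    · simpa [gridCell] using h2
    · simpa [gridCell] using h1 k
  · intro h
    exact ⟨fun k => by simpa [gridCell] using h (some k), by simpa [gridCell] using h none⟩

lemma measurableSet_isGrid {Ω : Type*} [MeasurableSpace Ω]
    {η : Ω → Measure (EuclideanSpace ℝ (Fin 2) × ℕ+)} (hη : Measurable η) (n : ℕ) :
    MeasurableSet {ω | IsGrid n (η ω)} := by
  simp only [isGrid_iff]
  rw [Set.ofPred_forall]
  exact .iInter fun o => (Measure.measurable_coe (measurableSet_gridCell n o)).comp hη
    (measurableSet_singleton _)

/-- The complement has intensity at most 9, so it is empty with probability at least e⁻⁹. A cell of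
intensity r ≤ 1 holds exactly one point with probability e⁻ʳ r ≥ e⁻¹ r, and there are 2(n+1) cells.
-/
lemma le_measure_isGrid {Ω : Type*} [MeasurableSpace Ω] {P : Measure Ω} {p : ℝ} (hp0 : 0 < p)
    (hp1 : p < 1) {η : Ω → Measure (EuclideanSpace ℝ (Fin 2) × ℕ+)}
    (hη : IsPoissonProcess η
      ((volume : Measure (EuclideanSpace ℝ (Fin 2))).prod (geometricMarks p)) P) (n : ℕ) :
    ENNReal.ofReal (Real.exp (-9) *
      (Real.exp (-1) * ((1 - p) / 4) * p ^ (2 * (n + 1)) / (n + 1)) ^ (2 * (n + 1)))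
      ≤ P {ω | IsGrid n (η ω)} := by
  set μ := (volume : Measure (EuclideanSpace ℝ (Fin 2))).prod (geometricMarks p) with hμ
  have hp2 : 0 < 1 - p := by linarith
  have hle : ∀ o, μ (gridCell n o) ≤ 9 := fun o =>
    (measure_mono (gridCell_subset n o)).trans_eq (volume_prod_coveringWindow hp0.le hp1)
  have hfin : ∀ o, μ (gridCell n o) ≠ ∞ := fun o => ne_top_of_le_ne_top (by simp) (hle o)
  simp only [isGrid_iff]
  rw [hη.measure_forall_eq (gridCell n) (measurableSet_gridCell n) (pairwise_disjoint_gridCell n)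
    hfin, Fintype.prod_option, ENNReal.ofReal_mul (by positivity), ENNReal.ofReal_pow (by positivity)]
  refine mul_le_mul' ?_ ?_
  · rw [poissonMeasure_singleton]
    refine ENNReal.ofReal_le_ofReal ?_
    have h9 : (((μ (gridCell n none)).toNNReal : ℝ≥0) : ℝ) ≤ 9 :=
      ENNReal.toReal_mono (b := 9) (by simp) (hle none)
    simpa using h9
  · have hcard : 2 * (n + 1) = (Finset.univ : Finset (Fin 2 × Fin (n + 1))).card := by simp
    rw [hcard, ← Finset.prod_const, ← hcard]
    refine Finset.prod_le_prod' fun k _ => ?_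
    rw [poissonMeasure_singleton]
    refine ENNReal.ofReal_le_ofReal ?_
    have hr : (((μ (gridCell n (some k))).toNNReal : ℝ≥0) : ℝ) =
        1 / (4 * (n + 1)) * ((1 - p) * p ^ (2 * n + (k.1 : ℕ))) := by
      rw [gridCell, hμ, volume_prod_stripCell hp0.le hp1]
      exact Real.coe_toNNReal _ (by positivity)
    rw [hr]
    set r := 1 / (4 * ((n : ℝ) + 1)) * ((1 - p) * p ^ (2 * n + (k.1 : ℕ)))
    have hr0 : 0 ≤ r := by positivity
    have hr1 : r ≤ 1 := by
      have h1 : 1 / (4 * ((n : ℝ) + 1)) ≤ 1 := by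
        rw [div_le_one (by positivity)]; linarith [(Nat.cast_nonneg n : (0 : ℝ) ≤ n)]
      have h2 : p ^ (2 * n + (k.1 : ℕ)) ≤ 1 := pow_le_one₀ hp0.le hp1.le
      exact mul_le_one₀ h1 (by positivity) (mul_le_one₀ (by linarith) (by positivity) h2)
    have hr2 : (1 - p) / 4 * p ^ (2 * (n + 1)) / (n + 1) ≤ r := by
      have h2 : p ^ (2 * (n + 1)) ≤ p ^ (2 * n + (k.1 : ℕ)) :=
        pow_le_pow_of_le_one hp0.le hp1.le (by lia)
      calc (1 - p) / 4 * p ^ (2 * (n + 1)) / (n + 1)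
          = 1 / (4 * ((n : ℝ) + 1)) * ((1 - p) * p ^ (2 * (n + 1))) := by field_simp
        _ ≤ r := by simp only [r]; gcongr
    calc Real.exp (-1) * ((1 - p) / 4) * p ^ (2 * (n + 1)) / (n + 1)
        = Real.exp (-1) * ((1 - p) / 4 * p ^ (2 * (n + 1)) / (n + 1)) := by ring
      _ ≤ Real.exp (-r) * r := by gcongr
      _ = _ := by simp

/-! ### Divergence of the expectation -/

lemma le_expTwoPow {Ω : Type*} [MeasurableSpace Ω] {P : Measure Ω} {p : ℝ} (hp0 : 0 < p)
    (hp1 : p < 1) {u : ℝ≥0} (hu : 0 < u) {η : Ω → Measure (EuclideanSpace ℝ (Fin 2) × ℕ+)}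
    (hη : IsPoissonProcess η
      ((volume : Measure (EuclideanSpace ℝ (Fin 2))).prod (geometricMarks p)) P) (n : ℕ) :
    ENNReal.ofReal (Real.exp (-9) * ((2 * p ^ 4) ^ (n + 1) *
      (Real.exp (-1) * ((1 - p) / 4)) ^ 2 / ((n + 1 : ℕ) : ℝ) ^ 2) ^ (n + 1))
      ≤ expTwoPow P (fun ω => excursionSet (thinKernel u) u (η ω)) := by
  have hp2 : 0 < 1 - p := by linarith
  calc _ = ENNReal.ofReal (2 ^ ((n + 1) ^ 2)) * ENNReal.ofReal (Real.exp (-9) *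
      (Real.exp (-1) * ((1 - p) / 4) * p ^ (2 * (n + 1)) / (n + 1)) ^ (2 * (n + 1))) := by
        rw [← ENNReal.ofReal_mul (by positivity)]
        congr 1
        have h1 : (2 : ℝ) ^ ((n + 1) ^ 2) = (2 ^ (n + 1)) ^ (n + 1) := by rw [← pow_mul, sq]
        rw [h1, pow_mul _ 2 (n + 1), mul_left_comm, ← mul_pow]
        congr 2
        push_cast
        rw [div_pow, mul_pow _ (p ^ _)]
        ring
    _ ≤ ENNReal.ofReal (2 ^ ((n + 1) ^ 2)) * P {ω | IsGrid n (η ω)} := by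
        gcongr; exact le_measure_isGrid hp0 hp1 hη n
    -- The grid event is measurable, so the integral of its indicator is exact; measurability of N
    -- is not needed for the comparison that follows.
    _ = ∫⁻ ω, {ω | IsGrid n (η ω)}.indicator (fun _ => ENNReal.ofReal (2 ^ ((n + 1) ^ 2))) ω ∂P :=
        (lintegral_indicator_const (measurableSet_isGrid hη.measurable n) _).symm
    _ ≤ _ := lintegral_mono fun ω => ?_
  by_cases hω : ω ∈ {ω | IsGrid n (η ω)}
  swap
  · rw [Set.indicator_of_notMem hω]
    exact zero_le
  rw [Set.indicator_of_mem hω]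
  have h := ENat.toENNReal_mono (ENat.epow_right_mono (x := 2) (by simp)
    (IsGrid.le_convexNumber hω (hη.counting ω) hu))
  refine le_trans (le_of_eq ?_) h
  simp only [ENat.epow_natCast, ENat.toENNReal_pow]
  rw [ENNReal.ofReal_pow (by norm_num)]
  norm_num

open Filter in
lemma expTwoPow_eq_top {Ω : Type*} [MeasurableSpace Ω] {P : Measure Ω} {p : ℝ} (hp0 : 0 < p)
    (hp1 : p < 1) (hp : 1 < 2 * p ^ 4) {u : ℝ≥0} (hu : 0 < u)
    {η : Ω → Measure (EuclideanSpace ℝ (Fin 2) × ℕ+)}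
    (hη : IsPoissonProcess η
      ((volume : Measure (EuclideanSpace ℝ (Fin 2))).prod (geometricMarks p)) P) :
    expTwoPow P (fun ω => excursionSet (thinKernel u) u (η ω)) = ∞ := by
  have hκ : 0 < Real.exp (-1) * ((1 - p) / 4) := by
    have : 0 < 1 - p := by linarith
    positivity
  set κ := Real.exp (-1) * ((1 - p) / 4)
  have h0 : Tendsto (fun n : ℕ => (n : ℝ) ^ 2 / (2 * p ^ 4) ^ n) atTop (nhds 0) :=
    tendsto_pow_const_div_const_pow_of_one_lt 2 hp
  -- Exponential growth beats the square, so the base of the (n+1)-th power is eventually at least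
  -- 2.
  have h1 : ∀ᶠ n : ℕ in atTop, 2 ≤ (2 * p ^ 4) ^ (n + 1) * κ ^ 2 / ((n + 1 : ℕ) : ℝ) ^ 2 := by
    filter_upwards [((tendsto_add_atTop_iff_nat 1).2 h0).eventually
      (gt_mem_nhds (show 0 < κ ^ 2 / 2 by positivity))] with n hn
    rw [div_lt_iff₀ (by positivity)] at hn
    rw [le_div_iff₀ (by positivity)]
    linarith
  have h2 : Tendsto (fun n : ℕ => ENNReal.ofReal (Real.exp (-9) * 2 ^ (n + 1))) atTop (nhds ∞) :=
    ENNReal.tendsto_ofReal_atTop.comp (((tendsto_add_atTop_iff_nat 1).2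
      (tendsto_pow_atTop_atTop_of_one_lt one_lt_two)).const_mul_atTop (Real.exp_pos _))
  refine top_le_iff.1 (le_of_tendsto h2 ?_)
  filter_upwards [h1] with n hn
  refine le_trans (ENNReal.ofReal_le_ofReal ?_) (le_expTwoPow hp0 hp1 hu hη n)
  gcongr

end ShotNoise

theorem mainTheorem7 {Ω : Type*} [MeasurableSpace Ω] (P : Measure Ω) [IsProbabilityMeasure P]
    (u : ℝ≥0) (hu : 0 < u) (p : ℝ) (hp : (2 : ℝ) ^ (-(1 / 4) : ℝ) < p) (hp1 : p < 1)
    (η : Ω → Measure (EuclideanSpace ℝ (Fin 2) × ℕ+))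
    (hη : ShotNoise.IsPoissonProcess η
      ((volume : Measure (EuclideanSpace ℝ (Fin 2))).prod (ShotNoise.geometricMarks p)) P) :
    (∀ᵐ ω ∂P, ShotNoise.IsPolyconvex
      (ShotNoise.excursionSet (ShotNoise.thinKernel u) u (η ω) ∩ ShotNoise.unitCube 2)) ∧
    ShotNoise.expTwoPow P
      (fun ω => ShotNoise.excursionSet (ShotNoise.thinKernel u) u (η ω)) = ∞ ∧
    ¬ ShotNoise.IsStandardRandomSet P
      (fun ω => ShotNoise.excursionSet (ShotNoise.thinKernel u) u (η ω)) := by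
  have h2 : (0 : ℝ) < 2 ^ (-(1 / 4) : ℝ) := by positivity
  have hp0 : 0 < p := h2.trans hp
  -- Fourth power of the lower bound on `p`: this is where the threshold 2^(-1/4) comes from.
  have hp4 : 1 < 2 * p ^ 4 := by
    have h := pow_lt_pow_left₀ hp h2.le (n := 4) (by norm_num)
    rw [← Real.rpow_mul_natCast (by norm_num)] at h
    norm_num at h
    linarith
  have htop := ShotNoise.expTwoPow_eq_top hp0 hp1 hp4 hu hη
  refine ⟨?_, htop, fun h => h.integrable.ne htop⟩
  have hfin := ShotNoise.volume_prod_coveringWindow hp0.le hp1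
  filter_upwards [hη.ae_ne_top ShotNoise.measurableSet_coveringWindow (by simp [hfin])] with ω hω
  exact ShotNoise.isPolyconvex_excursionSet (hη.counting ω) hω hu
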